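/- For a real random variable $Y$ and $\alpha>0$ let $\|Y\|_{\psi_\alpha}=\inf\{\eta>0:\ \mathbb E[\exp((|Y|/\eta)^\alpha)-1]\le 1\}$. For every $\alpha\in(0,2]$ the following holds. (i) There is a constant $C_\alpha>0$, depending only on $\alpha$, such that for all $n,p\ge 1$, all independent (not necessarily centred or identically distributed) random vectors $X_1,\dots,X_n$ in $\mathbb R^p$ and all $K_{n,p}<\infty$ with $\max_{1\le i\le n}\max_{1\le j\le p}\|X_i(j)\|_{\psi_\alpha}\le K_{n,p}$, and for every $t\ge 0$, with probability at least $1-3e^{-t}$, $$\Delta_n\ \le\ 7A_{n,p}\sqrt{\frac{t+2\log p}{n}}+\frac{C_\alpha K_{n,p}^2(\log(2n))^{2/\alpha}(t+2\log p)^{2/\alpha}}{n},$$ where $$\Delta_n=\max_{1\le j\le k\le p}\Big|\frac1n\sum_{i=1}^n\{X_i(j)X_i(k)-\mathbb E[X_i(j)X_i(k)]\}\Big|$$ is the maximum elementwise error of the sample Gram matrix $\frac1n\sum_i X_iX_i^\top$ and $A_{n,p}^2=\max_{1\le j\le k\le p}\frac1n\sum_{i=1}^n\mathrm{Var}(X_i(j)X_i(k))$.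 (ii) Consequently, let $p=p_n\ge 2$, let $0\le K_{n,p}<\infty$, and for each $n\ge1$ let $X_1,\dots,X_n$ be as in (i) (both the vectors and the probability space may change with $n$). Then, as $n\to\infty$, $$\Delta_n=O_{\mathbb P}\Big(\max\Big\{A_{n,p}\sqrt{\tfrac{\log p}{n}},\ K_{n,p}^2\tfrac{(\log n)^{2/\alpha}(\log p)^{2/\alpha}}{n}\Big\}\Big).$$ If moreover $(\log p)^{2/\alpha-1/2}=o(\sqrt n(\log n)^{-2/\alpha})$, then $\Delta_n=O_{\mathbb P}(K_{n,p}^2\sqrt{\log p/n})$ (the rate $\sqrt{\log p/n}$ when $K_{n,p}$ is bounded), and if in addition $K_{n,p}^2=O(A_{n,p})$, then $\Delta_n=O_{\mathbb P}(A_{n,p}\sqrt{\log p/n})$. Here $Y_n=O_{\mathbb P}(r_n)$ means that for every $\varepsilon>0$ there is $M>0$ with $\mathbb P(|Y_n|>Mr_n)\le\varepsilon$ for all large $n$. -/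

import Mathlib

open MeasureTheory ProbabilityTheory Filter Asymptotics
open scoped NNReal ENNReal

namespace SubWeibull

/-- The `g`-Orlicz norm `inf {η > 0 : E[g(|X|/η)] ≤ 1}` of a real random variable `X`,
as an extended nonnegative number (it is `∞` when no such `η` exists). -/
noncomputable def orliczNorm {Ω : Type*} [MeasurableSpace Ω] (μ : Measure Ω)
    (g : ℝ → ℝ) (X : Ω → ℝ) : ℝ≥0∞ :=
  sInf {c : ℝ≥0∞ | ∃ η : ℝ, 0 < η ∧
    ∫⁻ ω, ENNReal.ofReal (g (|X ω| / η)) ∂μ ≤ 1 ∧ c = ENNReal.ofReal η}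

/-- `ψ_α(x) = exp(x^α) - 1`, only used at `x ≥ 0`. -/
noncomputable def psi (α : ℝ) (x : ℝ) : ℝ := Real.exp (x ^ α) - 1

/-- The marginal sub-Weibull norm `sup_j ‖X(j)‖_{ψ_α}` of a random vector in `ℝ^p`. -/
noncomputable def marginalNorm {Ω : Type*} [MeasurableSpace Ω] (μ : Measure Ω)
    (α : ℝ) {p : ℕ} (X : Ω → Fin p → ℝ) : ℝ≥0∞ :=
  ⨆ j : Fin p, orliczNorm μ (psi α) (fun ω => X ω j)

/-- The sample Gram matrix `(1/n) ∑ᵢ Xᵢ Xᵢᵀ`. -/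
noncomputable def sampleGram {Ω : Type*} {n p : ℕ}
    (X : Fin n → Ω → Fin p → ℝ) (ω : Ω) : Matrix (Fin p) (Fin p) ℝ :=
  (1 / (n : ℝ)) • ∑ i, Matrix.vecMulVec (X i ω) (X i ω)

/-- The population Gram matrix `(1/n) ∑ᵢ E[Xᵢ Xᵢᵀ]`. -/
noncomputable def populationGram {Ω : Type*} [MeasurableSpace Ω] (μ : Measure Ω) {n p : ℕ}
    (X : Fin n → Ω → Fin p → ℝ) : Matrix (Fin p) (Fin p) ℝ :=
  (1 / (n : ℝ)) • ∑ i, Matrix.of fun j k => ∫ ω, X i ω j * X i ω k ∂μ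

open scoped Matrix.Norms.Elementwise in
/-- The error `Δ_n` of the sample Gram matrix in the elementwise maximum norm. -/
noncomputable def gramError {Ω : Type*} [MeasurableSpace Ω] (μ : Measure Ω) {n p : ℕ}
    (X : Fin n → Ω → Fin p → ℝ) (ω : Ω) : ℝ :=
  ‖sampleGram X ω - populationGram μ X‖

/-- `A_{n,p}`, the square root of `max_{j ≤ k} (1/n) ∑ᵢ Var(Xᵢ(j) Xᵢ(k))`. -/
noncomputable def varianceFactor {Ω : Type*} [MeasurableSpace Ω] (μ : Measure Ω) {n p : ℕ}
    (X : Fin n → Ω → Fin p → ℝ) : ℝ :=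
  √(⨆ jk : {jk : Fin p × Fin p // jk.1 ≤ jk.2},
      (1 / (n : ℝ)) * ∑ i, variance (fun ω => X i ω jk.1.1 * X i ω jk.1.2) μ)

/-- `Y_n = O_P(r_n)`: bounded in probability at rate `r_n`, where each `Y_n` may live on its own
probability space. -/
def IsBigOInProb {Ω : ℕ → Type*} [∀ n, MeasurableSpace (Ω n)] (μ : ∀ n, Measure (Ω n))
    (Y : ∀ n, Ω n → ℝ) (r : ℕ → ℝ) : Prop :=
  ∀ ε : ℝ, 0 < ε → ∃ M : ℝ, 0 < M ∧
    ∀ᶠ n in atTop, (μ n).real {ω | M * r n < |Y n ω|} ≤ ε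

end SubWeibull

/-! By AM-GM, a product of two coordinates with ψ_α-norms below K, divided by K², is a variable Y
with E exp(|Y|^b) ≤ 2, where b = α/2 ≤ 1 (`exp_abs_mul_rpow_le`). Each entry of the error is
therefore a rescaled sum of n independent centred variables of this kind.

For such sums (`measureReal_abs_sum_sub_integral_le`) every Y is clipped at L = (2 log 2n)^(1/b).
The clipped variables are bounded and have no larger variance, so Bernstein's inequality controls
them by 2√(sV) + 2Ls. The part beyond L may have no exponential moment, but its b-th power has one,
of size 1 + O(1/n) at parameter 1/2. The n moments multiply to a constant, and Chernoff bounds the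
sum of b-th powers by 2(s + 1). Superadditivity of x^(1/b) carries this over to the remainders
themselves. Clipping shifts each mean by only O(1/n).

A union bound over the p² entries costs 2 log p in the exponent. The rates follow by fixing t in
terms of ε and from A = O(K²). -/

namespace SubWeibull

/-! ### Bernstein's inequality and truncation -/

section Concentration

variable {Ω : Type*} [MeasurableSpace Ω] {μ : Measure Ω} [IsProbabilityMeasure μ]

/-- For |x| ≤ 1 one has e^x ≤ 1 + x + x². The linear term integrates to zero, and 1 + y ≤ e^y
finishes. -/
lemma mgf_le_of_abs_le {Z : Ω → ℝ} {l B : ℝ} (hZ : Measurable Z) (hl : 0 ≤ l)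
    (hB : ∀ ω, |Z ω| ≤ B) (hlB : l * B ≤ 1) (hmean : ∫ ω, Z ω ∂μ = 0) :
    mgf Z μ l ≤ Real.exp (l ^ 2 * ∫ ω, Z ω ^ 2 ∂μ) := by
  have hint : Integrable Z μ :=
    Integrable.of_bound hZ.aestronglyMeasurable B (ae_of_all _ fun ω => hB ω)
  have hint2 : Integrable (fun ω => Z ω ^ 2) μ :=
    Integrable.of_bound (hZ.pow_const 2).aestronglyMeasurable (B ^ 2) (ae_of_all _ fun ω => by
      rw [Real.norm_eq_abs, abs_pow]
      exact pow_le_pow_left₀ (abs_nonneg _) (hB ω) 2)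
  have hexp : Integrable (fun ω => Real.exp (l * Z ω)) μ :=
    integrable_exp_mul_of_le l B hl hZ.aemeasurable
      (ae_of_all _ fun ω => (le_abs_self _).trans (hB ω))
  have h1 : mgf Z μ l ≤ ∫ ω, (1 + l * Z ω + l ^ 2 * Z ω ^ 2) ∂μ := by
    refine integral_mono hexp
      (((integrable_const _).add (hint.const_mul l)).add (hint2.const_mul _)) fun ω => ?_
    have hx : |l * Z ω| ≤ 1 := by
      rw [abs_mul, abs_of_nonneg hl]
      exact (mul_le_mul_of_nonneg_left (hB ω) hl).trans hlB
    have := (abs_le.1 (Real.abs_exp_sub_one_sub_id_le hx)).2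
    simp only
    nlinarith
  have h2 : ∫ ω, (1 + l * Z ω + l ^ 2 * Z ω ^ 2) ∂μ = 1 + l ^ 2 * ∫ ω, Z ω ^ 2 ∂μ := by
    have hi : Integrable (fun ω => 1 + l * Z ω) μ := (integrable_const _).add (hint.const_mul l)
    rw [integral_add hi (hint2.const_mul _), integral_add (integrable_const _) (hint.const_mul l),
      integral_const_mul, integral_const_mul, hmean]
    simp
  rw [h2] at h1
  linarith [Real.add_one_le_exp (l ^ 2 * ∫ ω, Z ω ^ 2 ∂μ)]

/-- A Bernstein inequality for bounded centred independent variables. -/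
lemma measureReal_sum_ge_le_exp {n : ℕ} {Z : Fin n → Ω → ℝ} {B V s : ℝ}
    (hZ : ∀ i, Measurable (Z i)) (hind : iIndepFun Z μ) (hB0 : 0 < B)
    (hB : ∀ i ω, |Z i ω| ≤ B) (hmean : ∀ i, ∫ ω, Z i ω ∂μ = 0)
    (hV : ∑ i, ∫ ω, Z i ω ^ 2 ∂μ ≤ V) (hs : 0 < s) :
    μ.real {ω | 2 * √(s * V) + B * s ≤ ∑ i, Z i ω} ≤ Real.exp (-s) := by
  have hV0 : 0 ≤ V := (Finset.sum_nonneg fun i _ => integral_nonneg fun ω => sq_nonneg _).trans hV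
  set q := √(V / s) with hq
  have hq0 : 0 ≤ q := Real.sqrt_nonneg _
  have hqq : V = q ^ 2 * s := by
    rw [hq, Real.sq_sqrt (by positivity)]; field_simp
  have hsV : √(s * V) = q * s := by
    rw [hqq, show s * (q ^ 2 * s) = (q * s) ^ 2 by ring, Real.sqrt_sq (by positivity)]
  -- With V = q²s the Chernoff exponent at this l is -s - (lq)s + (lq)²s, which is at most -s
  -- because lq ≤ 1. The case V = 0 is covered, with q = 0.
  set l := (B + q)⁻¹ with hl
  have hBq : 0 < B + q := by positivity
  have hl0 : 0 < l := inv_pos.2 hBq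
  have hlB : l * B ≤ 1 := by
    rw [hl, inv_mul_le_iff₀ hBq]; linarith
  have hl1 : l * (B + q) = 1 := inv_mul_cancel₀ hBq.ne'
  have hbd : ∀ i, Integrable (fun ω => Real.exp (l * Z i ω)) μ := fun i =>
    integrable_exp_mul_of_le l B hl0.le (hZ i).aemeasurable
      (ae_of_all _ fun ω => (le_abs_self _).trans (hB i ω))
  have hint := hind.integrable_exp_mul_sum hZ (s := Finset.univ) (fun i _ => hbd i)
  have hch := measure_ge_le_exp_mul_mgf (2 * √(s * V) + B * s) hl0.le hint
  rw [hind.mgf_sum hZ] at hch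
  have hprod : ∏ i, mgf (Z i) μ l ≤ Real.exp (l ^ 2 * V) := by
    calc ∏ i, mgf (Z i) μ l ≤ ∏ i, Real.exp (l ^ 2 * ∫ ω, Z i ω ^ 2 ∂μ) :=
          Finset.prod_le_prod (fun i _ => mgf_nonneg)
            (fun i _ => mgf_le_of_abs_le (hZ i) hl0.le (hB i) hlB (hmean i))
      _ = Real.exp (l ^ 2 * ∑ i, ∫ ω, Z i ω ^ 2 ∂μ) := by
          rw [← Real.exp_sum, Finset.mul_sum]
      _ ≤ Real.exp (l ^ 2 * V) := by gcongr
  simp only [Finset.sum_apply] at hch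
  refine hch.trans ((mul_le_mul_of_nonneg_left hprod (Real.exp_nonneg _)).trans ?_)
  rw [← Real.exp_add, Real.exp_le_exp, hsV, hqq]
  have hlq : l * q ≤ 1 := by nlinarith
  have h3 : l * (2 * (q * s) + B * s) = s + (l * q) * s := by linear_combination s * hl1
  have h4 : l ^ 2 * (q ^ 2 * s) = (l * q) ^ 2 * s := by ring
  have h5 : (l * q) ^ 2 ≤ l * q := by nlinarith [mul_nonneg hl0.le hq0]
  nlinarith

/-- Truncation of `y` to the interval `[-L, L]`. -/
noncomputable def clip (L y : ℝ) : ℝ := max (-L) (min y L)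

lemma measurable_clip (L : ℝ) : Measurable (clip L) := by unfold clip; fun_prop

lemma abs_clip_le {L : ℝ} (hL : 0 ≤ L) (y : ℝ) : |clip L y| ≤ L := by
  unfold clip; rw [abs_le]; grind

lemma abs_clip_sub_clip_le (L x y : ℝ) : |clip L x - clip L y| ≤ |x - y| := by
  unfold clip
  rw [max_comm, max_comm (-L)]
  refine (abs_max_sub_max_le_abs _ _ _).trans ((abs_min_sub_min_le_max x L y L).trans ?_)
  simp

lemma abs_sub_clip_le {L : ℝ} (hL : 0 ≤ L) (y : ℝ) :
    |y - clip L y| ≤ if L < |y| then |y| else 0 := by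
  unfold clip; split_ifs with h <;> grind

/-- Clipping is 1-Lipschitz, and a variance is at most the second moment about any point, here about
the clipped mean of Y. -/
lemma variance_clip_le {Y : Ω → ℝ} {L : ℝ} (hY : Measurable Y) (hY2 : MemLp Y 2 μ) :
    ∫ ω, (clip L (Y ω) - ∫ ω', clip L (Y ω') ∂μ) ^ 2 ∂μ ≤ variance Y μ := by
  have hm : Measurable fun ω => clip L (Y ω) := (measurable_clip L).comp hY
  rw [← variance_eq_integral hm.aemeasurable,
    ← variance_sub_const hm.aestronglyMeasurable (clip L (∫ ω, Y ω ∂μ)),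
    variance_eq_integral (X := Y) hY.aemeasurable]
  refine (variance_le_expectation_sq (hm.sub_const _).aestronglyMeasurable).trans ?_
  refine integral_mono_of_nonneg (ae_of_all _ fun ω => sq_nonneg _)
    (hY2.sub (memLp_const _)).integrable_sq (ae_of_all _ fun ω => ?_)
  exact sq_le_sq.2 (abs_clip_sub_clip_le _ _ _)

end Concentration

/-! ### Elementary inequalities for powers and exponentials -/

lemma sum_rpow_le_rpow_sum {ι : Type*} (s : Finset ι) {f : ι → ℝ} {r : ℝ} (hr : 1 ≤ r)
    (hf : ∀ i ∈ s, 0 ≤ f i) : ∑ i ∈ s, f i ^ r ≤ (∑ i ∈ s, f i) ^ r := by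
  classical
  induction s using Finset.induction_on with
  | empty => simp [Real.zero_rpow (by linarith : r ≠ 0)]
  | insert a s ha ih =>
    rw [Finset.sum_insert ha, Finset.sum_insert ha]
    have h := ih fun i hi => hf i (Finset.mem_insert_of_mem hi)
    exact (add_le_add_right h _).trans (Real.add_rpow_le_rpow_add (hf a (by simp))
      (Finset.sum_nonneg fun i hi => hf i (Finset.mem_insert_of_mem hi)) hr)

/-- With u = y^b, raise u ≤ (2/b) exp(bu/2) to the power 1/b. Only half of the exponent is spent, so
the square of y still costs no more than exp(y^b). -/
lemma le_mul_exp_rpow {b y : ℝ} (hb : 0 < b) (hy : 0 ≤ y) :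
    y ≤ (2 / b) ^ (1 / b) * Real.exp (y ^ b / 2) := by
  set u := y ^ b with hu
  have hu0 : 0 ≤ u := by positivity
  have hy' : y = u ^ (1 / b) := by
    rw [hu, ← Real.rpow_mul hy, mul_one_div_cancel hb.ne', Real.rpow_one]
  have h1 : u ≤ (2 / b) * Real.exp (b * u / 2) := by
    have := Real.add_one_le_exp (b * u / 2)
    calc u = (2 / b) * (b * u / 2) := by field_simp
      _ ≤ _ := by gcongr; linarith
  calc y = u ^ (1 / b) := hy'
    _ ≤ ((2 / b) * Real.exp (b * u / 2)) ^ (1 / b) := by gcongr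
    _ = (2 / b) ^ (1 / b) * Real.exp (u / 2) := by
      rw [Real.mul_rpow (by positivity) (Real.exp_nonneg _), ← Real.exp_mul]
      congr 2; field_simp

/-! ### Sums of independent sub-Weibull variables -/

section Scalar

variable {Ω : Type*} [MeasurableSpace Ω] {μ : Measure Ω}

lemma integral_sq_le_of_integral_exp_le {Y : Ω → ℝ} {b : ℝ} (hb : 0 < b)
    (hY : Measurable Y) (hint : Integrable (fun ω => Real.exp (|Y ω| ^ b)) μ)
    (hle : ∫ ω, Real.exp (|Y ω| ^ b) ∂μ ≤ 2) :
    MemLp Y 2 μ ∧ ∫ ω, Y ω ^ 2 ∂μ ≤ 2 * ((2 / b) ^ (1 / b)) ^ 2 := by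
  have hpt : ∀ ω, Y ω ^ 2 ≤ ((2 / b) ^ (1 / b)) ^ 2 * Real.exp (|Y ω| ^ b) := fun ω => by
    have h := pow_le_pow_left₀ (abs_nonneg _) (le_mul_exp_rpow hb (abs_nonneg (Y ω))) 2
    rwa [sq_abs, mul_pow, ← Real.exp_nat_mul, Nat.cast_ofNat, mul_div_cancel₀ _ two_ne_zero] at h
  have hi : Integrable (fun ω => Y ω ^ 2) μ :=
    (hint.const_mul _).mono' (hY.pow_const 2).aestronglyMeasurable
      (ae_of_all _ fun ω => by
        rw [Real.norm_eq_abs, abs_of_nonneg (sq_nonneg _)]; exact hpt ω)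
  refine ⟨(memLp_two_iff_integrable_sq hY.aestronglyMeasurable).2 hi, ?_⟩
  calc ∫ ω, Y ω ^ 2 ∂μ ≤ ∫ ω, ((2 / b) ^ (1 / b)) ^ 2 * Real.exp (|Y ω| ^ b) ∂μ :=
        integral_mono hi (hint.const_mul _) hpt
    _ ≤ _ := by
      rw [integral_const_mul, mul_comm]
      gcongr

/-- Beyond the level `L = (2 log m)^{1/b}` the `exp(|·|^b / 2)`-moment is at most `2 / m`. -/
lemma integral_tail_exp_le {Y : Ω → ℝ} {b m : ℝ} (hb : 0 < b) (hm : 1 ≤ m)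
    (hY : Measurable Y) (hint : Integrable (fun ω => Real.exp (|Y ω| ^ b)) μ)
    (hle : ∫ ω, Real.exp (|Y ω| ^ b) ∂μ ≤ 2) :
    Integrable (fun ω => if (2 * Real.log m) ^ (1 / b) < |Y ω| then
        Real.exp (|Y ω| ^ b / 2) else 0) μ ∧
      ∫ ω, (if (2 * Real.log m) ^ (1 / b) < |Y ω| then
        Real.exp (|Y ω| ^ b / 2) else 0) ∂μ ≤ 2 / m := by
  have hl : 0 ≤ 2 * Real.log m := by have := Real.log_nonneg hm; positivity
  -- Beyond the level |Y|^b ≥ 2 log m, so halving the exponent gains a factor exp(-|Y|^b / 2) ≤ 1/m.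
  have hpt : ∀ ω, (if (2 * Real.log m) ^ (1 / b) < |Y ω| then
      Real.exp (|Y ω| ^ b / 2) else 0) ≤ m⁻¹ * Real.exp (|Y ω| ^ b) := fun ω => by
    split_ifs with h
    · have h1 : 2 * Real.log m ≤ |Y ω| ^ b := by
        have := Real.rpow_le_rpow (by positivity) h.le hb.le
        rwa [← Real.rpow_mul hl, one_div_mul_cancel hb.ne', Real.rpow_one] at this
      have h2 : m⁻¹ = Real.exp (-Real.log m) := by
        rw [Real.exp_neg, Real.exp_log (by linarith)]
      rw [h2, ← Real.exp_add, Real.exp_le_exp]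
      linarith
    · positivity
  have hmeas : Measurable fun ω => if (2 * Real.log m) ^ (1 / b) < |Y ω| then
      Real.exp (|Y ω| ^ b / 2) else 0 := by
    refine Measurable.ite (measurableSet_lt measurable_const (by fun_prop)) ?_ measurable_const
    fun_prop
  have hi := (hint.const_mul m⁻¹).mono' hmeas.aestronglyMeasurable (ae_of_all _ fun ω => by
    rw [Real.norm_eq_abs, abs_of_nonneg (by split_ifs <;> positivity)]; exact hpt ω)
  refine ⟨hi, (integral_mono hi (hint.const_mul _) hpt).trans ?_⟩
  rw [integral_const_mul, div_eq_inv_mul]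
  gcongr

variable [IsProbabilityMeasure μ]

/-- The part of `|y|^b` beyond the level `L`. -/
noncomputable def excess (b L y : ℝ) : ℝ := if L < |y| then |y| ^ b else 0

lemma measurable_excess (b L : ℝ) : Measurable (excess b L) :=
  Measurable.ite (measurableSet_lt measurable_const (by fun_prop)) (by fun_prop) measurable_const

lemma excess_nonneg (b L y : ℝ) : 0 ≤ excess b L y := by
  unfold excess; split_ifs <;> positivity

/-- The remainder is traded for its b-th power, which has the exponential moment needed for
Chernoff. -/
lemma abs_sub_clip_le_excess {b L : ℝ} (hb : 0 < b) (hL : 0 ≤ L) (y : ℝ) :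
    |y - clip L y| ≤ excess b L y ^ (1 / b) := by
  refine (abs_sub_clip_le hL y).trans ?_
  unfold excess
  split_ifs
  · rw [← Real.rpow_mul (abs_nonneg _), mul_one_div_cancel hb.ne', Real.rpow_one]
  · positivity

/-- The exponential is 1 below the level, so the tail moment adds at most 2/m. With m = 2n the
product of n such bounds is e. -/
lemma mgf_excess_le {Y : Ω → ℝ} {b m : ℝ} (hb : 0 < b) (hm : 1 ≤ m)
    (hY : Measurable Y) (hint : Integrable (fun ω => Real.exp (|Y ω| ^ b)) μ)
    (hle : ∫ ω, Real.exp (|Y ω| ^ b) ∂μ ≤ 2) :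
    Integrable (fun ω => Real.exp (1 / 2 * excess b ((2 * Real.log m) ^ (1 / b)) (Y ω))) μ ∧
      mgf (fun ω => excess b ((2 * Real.log m) ^ (1 / b)) (Y ω)) μ (1 / 2) ≤
        Real.exp (2 / m) := by
  obtain ⟨hi, hI⟩ := integral_tail_exp_le hb hm hY hint hle
  have hpt : ∀ ω, Real.exp (1 / 2 * excess b ((2 * Real.log m) ^ (1 / b)) (Y ω)) ≤
      1 + if (2 * Real.log m) ^ (1 / b) < |Y ω| then Real.exp (|Y ω| ^ b / 2) else 0 :=
    fun ω => by
      unfold excess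
      split_ifs
      · rw [one_div_mul_eq_div]; linarith
      · simp
  have hi' := (integrable_const (1 : ℝ)).add hi
  have hW : Integrable
      (fun ω => Real.exp (1 / 2 * excess b ((2 * Real.log m) ^ (1 / b)) (Y ω))) μ :=
    hi'.mono' (((measurable_excess b _).comp hY).const_mul _).exp.aestronglyMeasurable
      (ae_of_all _ fun ω => by rw [Real.norm_eq_abs, Real.abs_exp]; exact hpt ω)
  refine ⟨hW, (integral_mono hW hi' hpt).trans ?_⟩
  simp only [Pi.add_apply]
  rw [integral_add (integrable_const _) hi]
  simp only [integral_const, probReal_univ, smul_eq_mul, mul_one]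
  linarith [Real.add_one_le_exp (2 / m)]

/-- This is the bias due to clipping. With m = 2n, the n biases add up to at most (2/b)^(1/b). -/
lemma integral_abs_sub_clip_le {Y : Ω → ℝ} {b m : ℝ} (hb : 0 < b) (hm : 1 ≤ m)
    (hY : Measurable Y) (hint : Integrable (fun ω => Real.exp (|Y ω| ^ b)) μ)
    (hle : ∫ ω, Real.exp (|Y ω| ^ b) ∂μ ≤ 2) :
    |∫ ω, Y ω ∂μ - ∫ ω, clip ((2 * Real.log m) ^ (1 / b)) (Y ω) ∂μ| ≤
      (2 / b) ^ (1 / b) * (2 / m) := by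
  obtain ⟨hi, hI⟩ := integral_tail_exp_le hb hm hY hint hle
  have hL : 0 ≤ (2 * Real.log m) ^ (1 / b) := by have := Real.log_nonneg hm; positivity
  have hYi : Integrable Y μ :=
    (integral_sq_le_of_integral_exp_le hb hY hint hle).1.integrable one_le_two
  have hci : Integrable (fun ω => clip ((2 * Real.log m) ^ (1 / b)) (Y ω)) μ :=
    Integrable.of_bound ((measurable_clip _).comp hY).aestronglyMeasurable _
      (ae_of_all _ fun ω => abs_clip_le hL _)
  rw [← integral_sub hYi hci]
  refine (abs_integral_le_integral_abs).trans ?_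
  calc _ ≤ ∫ ω, (2 / b) ^ (1 / b) * (if (2 * Real.log m) ^ (1 / b) < |Y ω| then
        Real.exp (|Y ω| ^ b / 2) else 0) ∂μ := by
        refine integral_mono (hYi.sub hci).abs (hi.const_mul _) fun ω => ?_
        refine (abs_sub_clip_le hL _).trans ?_
        split_ifs
        · exact le_mul_exp_rpow hb (abs_nonneg _)
        · simp
    _ ≤ _ := by
      rw [integral_const_mul]
      gcongr

/-- The constant of the sub-Weibull concentration inequality with exponent `b`. -/
noncomputable def scalarConst (b : ℝ) : ℝ :=
  2 ^ (1 / b) * (2 + 4 ^ (1 / b) + (2 / b) ^ (1 / b))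

lemma scalarConst_pos {b : ℝ} (hb : 0 < b) : 0 < scalarConst b := by
  unfold scalarConst; positivity

/-- With x = log(2n), the three terms on the left are the range term of Bernstein, the excess and
the bias. They merge because (2x)^(1/b) ≥ 1 and s ≤ s^(1/b). -/
lemma scalarConst_bound {b x s : ℝ} (hb : 0 < b) (hb1 : b ≤ 1) (hx : 1 / 2 ≤ x) (hs : 1 ≤ s) :
    2 * (2 * x) ^ (1 / b) * s + (2 * (s + 1)) ^ (1 / b) + (2 / b) ^ (1 / b) ≤
      scalarConst b * x ^ (1 / b) * s ^ (1 / b) := by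
  have hr : 1 ≤ 1 / b := by rwa [le_div_iff₀ hb, one_mul]
  have hr0 : 0 ≤ 1 / b := by positivity
  have hx1 : 1 ≤ (2 * x) ^ (1 / b) := Real.one_le_rpow (by linarith) hr0
  have hs1 : s ≤ s ^ (1 / b) := Real.self_le_rpow_of_one_le hs hr
  have h4 : (2 * (s + 1)) ^ (1 / b) ≤ 4 ^ (1 / b) * s ^ (1 / b) := by
    rw [← Real.mul_rpow (by norm_num) (by linarith)]
    exact Real.rpow_le_rpow (by linarith) (by linarith) hr0
  have hC : scalarConst b * x ^ (1 / b) * s ^ (1 / b) =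
      2 * (2 * x) ^ (1 / b) * s ^ (1 / b) + (2 * x) ^ (1 / b) * (4 ^ (1 / b) * s ^ (1 / b)) +
        (2 * x) ^ (1 / b) * (s ^ (1 / b) * (2 / b) ^ (1 / b)) := by
    rw [scalarConst, Real.mul_rpow (by norm_num) (by linarith)]; ring
  have h4' : (0 : ℝ) ≤ 4 ^ (1 / b) * s ^ (1 / b) := by positivity
  have hD : 0 ≤ (2 / b) ^ (1 / b) := by positivity
  rw [hC]
  refine add_le_add (add_le_add ?_ ?_) ?_
  · gcongr
  · exact h4.trans (le_mul_of_one_le_left h4' hx1)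
  · calc (2 / b) ^ (1 / b) ≤ s ^ (1 / b) * (2 / b) ^ (1 / b) :=
          le_mul_of_one_le_left hD (hs.trans hs1)
      _ ≤ _ := le_mul_of_one_le_left (by positivity) hx1

lemma measureReal_sum_excess_le {n : ℕ} (hn : 1 ≤ n) {Y : Fin n → Ω → ℝ} {b s : ℝ} (hb : 0 < b)
    (hY : ∀ i, Measurable (Y i)) (hind : iIndepFun Y μ)
    (hint : ∀ i, Integrable (fun ω => Real.exp (|Y i ω| ^ b)) μ)
    (hle : ∀ i, ∫ ω, Real.exp (|Y i ω| ^ b) ∂μ ≤ 2) :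
    μ.real {ω | 2 * (s + 1) ≤ ∑ i, excess b ((2 * Real.log (2 * n)) ^ (1 / b)) (Y i ω)} ≤
      Real.exp (-s) := by
  have hn' : (1 : ℝ) ≤ n := by exact_mod_cast hn
  have hm : (1 : ℝ) ≤ 2 * n := by linarith
  set L := (2 * Real.log (2 * n)) ^ (1 / b)
  have hmeas : ∀ i, Measurable fun ω => excess b L (Y i ω) := fun i =>
    (measurable_excess b L).comp (hY i)
  have hind' : iIndepFun (fun i ω => excess b L (Y i ω)) μ :=
    hind.comp (fun _ => excess b L) fun _ => measurable_excess b L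
  have hW := fun i => mgf_excess_le hb hm (hY i) (hint i) (hle i)
  have hch := measure_ge_le_exp_mul_mgf (2 * (s + 1)) (by norm_num : (0 : ℝ) ≤ 1 / 2)
    (hind'.integrable_exp_mul_sum hmeas (s := Finset.univ) fun i _ => (hW i).1)
  rw [hind'.mgf_sum hmeas] at hch
  simp only [Finset.sum_apply] at hch
  have hprod : ∏ i, mgf (fun ω => excess b L (Y i ω)) μ (1 / 2) ≤ Real.exp 1 := by
    calc _ ≤ ∏ _i : Fin n, Real.exp (2 / (2 * n)) :=
          Finset.prod_le_prod (fun i _ => mgf_nonneg) fun i _ => (hW i).2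
      _ = Real.exp 1 := by
          rw [Finset.prod_const, Finset.card_univ, Fintype.card_fin, ← Real.exp_nat_mul]
          congr 1; field_simp
  refine hch.trans ((mul_le_mul_of_nonneg_left hprod (Real.exp_nonneg _)).trans ?_)
  rw [← Real.exp_add]
  exact Real.exp_le_exp.2 (by linarith)

/-- Concentration of sums of independent sub-Weibull variables of order `b ≤ 1`. -/
theorem measureReal_abs_sum_sub_integral_le {n : ℕ} (hn : 1 ≤ n) {Y : Fin n → Ω → ℝ} {b s V : ℝ}
    (hb : 0 < b) (hb1 : b ≤ 1)
    (hY : ∀ i, Measurable (Y i)) (hind : iIndepFun Y μ)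
    (hint : ∀ i, Integrable (fun ω => Real.exp (|Y i ω| ^ b)) μ)
    (hle : ∀ i, ∫ ω, Real.exp (|Y i ω| ^ b) ∂μ ≤ 2)
    (hV : ∑ i, variance (Y i) μ ≤ V) (hs : 1 ≤ s) :
    μ.real {ω | 2 * √(s * V) + scalarConst b * Real.log (2 * n) ^ (1 / b) * s ^ (1 / b) <
      |∑ i, (Y i ω - ∫ ω', Y i ω' ∂μ)|} ≤ 3 * Real.exp (-s) := by
  have hn' : (1 : ℝ) ≤ n := by exact_mod_cast hn
  have hm : (1 : ℝ) ≤ 2 * n := by linarith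
  have hlog : 1 / 2 ≤ Real.log (2 * n) := by
    have h1 : Real.log 2 ≤ Real.log (2 * n) := Real.log_le_log (by norm_num) (by linarith)
    linarith [Real.log_two_gt_d9]
  set L := (2 * Real.log (2 * n)) ^ (1 / b) with hLdef
  have hL : 0 < L := by positivity
  set e : Fin n → ℝ := fun i => ∫ ω, clip L (Y i ω) ∂μ with he
  set Z : Fin n → Ω → ℝ := fun i ω => clip L (Y i ω) - e i with hZdef
  have hcm : ∀ i, Measurable fun ω => clip L (Y i ω) := fun i => (measurable_clip L).comp (hY i)
  have hci : ∀ i, Integrable (fun ω => clip L (Y i ω)) μ := fun i =>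
    Integrable.of_bound (hcm i).aestronglyMeasurable L (ae_of_all _ fun ω => abs_clip_le hL.le _)
  have hZ : ∀ i, Measurable (Z i) := fun i => (hcm i).sub_const _
  have hZind : iIndepFun Z μ :=
    hind.comp (fun i y => clip L y - e i) fun i => (measurable_clip L).sub_const _
  have heL : ∀ i, |e i| ≤ L := fun i => by
    have := norm_integral_le_of_norm_le_const (μ := μ) (f := fun ω => clip L (Y i ω)) (C := L)
      (ae_of_all _ fun ω => abs_clip_le hL.le _)
    simpa using this
  have hZB : ∀ i ω, |Z i ω| ≤ 2 * L := fun i ω =>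
    (abs_sub _ _).trans (by linarith [abs_clip_le hL.le (Y i ω), heL i])
  have hZ0 : ∀ i, ∫ ω, Z i ω ∂μ = 0 := fun i => by
    simp only [hZdef]
    rw [integral_sub (hci i) (integrable_const _)]
    simp [he]
  have hZV : ∑ i, ∫ ω, Z i ω ^ 2 ∂μ ≤ V :=
    (Finset.sum_le_sum fun i _ => variance_clip_le (hY i)
      (integral_sq_le_of_integral_exp_le hb (hY i) (hint i) (hle i)).1).trans hV
  have hs0 : 0 < s := by linarith
  have hup := measureReal_sum_ge_le_exp hZ hZind (by positivity : 0 < 2 * L) hZB hZ0 hZV hs0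
  have hlo := measureReal_sum_ge_le_exp (Z := fun i ω => -Z i ω) (fun i => (hZ i).neg)
    (hZind.comp (fun _ y => -y) fun _ => measurable_neg) (by positivity : 0 < 2 * L)
    (fun i ω => by rw [abs_neg]; exact hZB i ω) (fun i => by rw [integral_neg, hZ0, neg_zero])
    (by simpa only [neg_sq] using hZV) hs0
  have hex := measureReal_sum_excess_le (s := s) hn hb hY hind hint hle
  rw [← hLdef] at hex
  have hconst := scalarConst_bound hb hb1 hlog hs
  rw [← hLdef] at hconst
  -- A large deviation forces one of three events of probability at most exp(-s): an upper or a
  -- lower deviation of the clipped sum, or a large total excess.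
  refine (measureReal_mono (s₂ := ({ω | 2 * √(s * V) + 2 * L * s ≤ ∑ i, Z i ω} ∪
      {ω | 2 * √(s * V) + 2 * L * s ≤ ∑ i, -Z i ω}) ∪
      {ω | 2 * (s + 1) ≤ ∑ i, excess b L (Y i ω)}) ?_).trans ?_
  · intro ω hω
    by_contra hcon
    simp only [Set.mem_union, Set.mem_ofPred_eq, not_or, not_le] at hcon hω
    obtain ⟨⟨h1, h2⟩, h3⟩ := hcon
    rw [Finset.sum_neg_distrib] at h2
    have hW0 : ∀ i ∈ Finset.univ, 0 ≤ excess b L (Y i ω) := fun i _ => excess_nonneg _ _ _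
    have hrem : |∑ i, (Y i ω - clip L (Y i ω))| ≤ (2 * (s + 1)) ^ (1 / b) := by
      refine (Finset.abs_sum_le_sum_abs _ _).trans ?_
      refine (Finset.sum_le_sum fun i _ => abs_sub_clip_le_excess hb hL.le (Y i ω)).trans ?_
      -- This step uses b ≤ 1, in the form 1/b ≥ 1.
      refine (sum_rpow_le_rpow_sum _ (by rwa [le_div_iff₀ hb, one_mul]) hW0).trans ?_
      exact Real.rpow_le_rpow (Finset.sum_nonneg hW0) h3.le (by positivity)
    have hmean : |∑ i, (∫ ω', Y i ω' ∂μ - e i)| ≤ (2 / b) ^ (1 / b) := by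
      refine (Finset.abs_sum_le_sum_abs _ _).trans ?_
      refine (Finset.sum_le_sum fun i _ =>
        integral_abs_sub_clip_le hb hm (hY i) (hint i) (hle i)).trans ?_
      rw [Finset.sum_const, Finset.card_univ, Fintype.card_fin, nsmul_eq_mul]
      apply le_of_eq; field_simp
    have hsplit : ∑ i, (Y i ω - ∫ ω', Y i ω' ∂μ) = ∑ i, Z i ω +
        ∑ i, (Y i ω - clip L (Y i ω)) - ∑ i, (∫ ω', Y i ω' ∂μ - e i) := by
      rw [← Finset.sum_add_distrib, ← Finset.sum_sub_distrib]
      refine Finset.sum_congr rfl fun i _ => ?_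
      simp only [hZdef]; ring
    have hZabs : |∑ i, Z i ω| ≤ 2 * √(s * V) + 2 * L * s := abs_le.2 ⟨by linarith, h1.le⟩
    have htri := (abs_sub (∑ i, Z i ω + ∑ i, (Y i ω - clip L (Y i ω)))
      (∑ i, (∫ ω', Y i ω' ∂μ - e i))).trans (add_le_add_left (abs_add_le _ _) _)
    rw [← hsplit] at htri
    linarith
  · refine (measureReal_union_le _ _).trans ?_
    have := measureReal_union_le (μ := μ) {ω | 2 * √(s * V) + 2 * L * s ≤ ∑ i, Z i ω}
      {ω | 2 * √(s * V) + 2 * L * s ≤ ∑ i, -Z i ω}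
    linarith

end Scalar

/-! ### From coordinate products to the Gram matrix -/

section Gram

variable {Ω : Type*} [MeasurableSpace Ω] {μ : Measure Ω} [IsProbabilityMeasure μ]

/-- Strictness provides an admissible η < K, and monotonicity of ψ_α passes from η to K, so
attainment of the infimum is not needed. -/
lemma integral_exp_le_of_orliczNorm_lt {X : Ω → ℝ} {α K : ℝ} (hα : 0 < α) (hX : Measurable X)
    (hK : orliczNorm μ (psi α) X < ENNReal.ofReal K) :
    Integrable (fun ω => Real.exp ((|X ω| / K) ^ α)) μ ∧
      ∫ ω, Real.exp ((|X ω| / K) ^ α) ∂μ ≤ 2 := by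
  obtain ⟨c, ⟨η, hη, hle, rfl⟩, hc⟩ := sInf_lt_iff.1 hK
  have hηK : η < K := ENNReal.ofReal_lt_ofReal_iff'.1 hc |>.1
  have hK0 : 0 < K := hη.trans hηK
  have h0 : ∀ ω, 0 ≤ psi α (|X ω| / K) := fun ω => by
    unfold psi
    have := Real.one_le_exp (x := (|X ω| / K) ^ α) (by positivity)
    linarith
  have hle' : ∫⁻ ω, ENNReal.ofReal (psi α (|X ω| / K)) ∂μ ≤ 1 := by
    refine (lintegral_mono fun ω => ENNReal.ofReal_le_ofReal ?_).trans hle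
    unfold psi
    gcongr
  have hm : Measurable fun ω => psi α (|X ω| / K) := by unfold psi; fun_prop
  have hi : Integrable (fun ω => psi α (|X ω| / K)) μ :=
    ⟨hm.aestronglyMeasurable, by
      rw [hasFiniteIntegral_iff_ofReal (ae_of_all _ h0)]
      exact hle'.trans_lt ENNReal.one_lt_top⟩
  have hI : ∫ ω, psi α (|X ω| / K) ∂μ ≤ 1 := by
    rw [integral_eq_lintegral_of_nonneg_ae (ae_of_all _ h0) hm.aestronglyMeasurable]
    exact ENNReal.toReal_le_of_le_ofReal zero_le_one (by simpa using hle')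
  have heq : (fun ω => Real.exp ((|X ω| / K) ^ α)) = fun ω => psi α (|X ω| / K) + 1 := by
    funext ω; simp [psi]
  rw [heq]
  refine ⟨hi.add (integrable_const _), ?_⟩
  rw [integral_add hi (integrable_const _)]
  simp only [integral_const, probReal_univ, smul_eq_mul, mul_one]
  linarith

/-- AM-GM is used twice: on the exponent, pq ≤ (p² + q²)/2, and then on the product of the two
exponentials. The average preserves the moment bound 2. -/
lemma exp_abs_mul_rpow_le {x y K α : ℝ} (hK : 0 < K) :
    Real.exp (|(K ^ 2)⁻¹ * (x * y)| ^ (α / 2)) ≤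
      (Real.exp ((|x| / K) ^ α) + Real.exp ((|y| / K) ^ α)) / 2 := by
  have hu : 0 ≤ |x| / K := by positivity
  have hv : 0 ≤ |y| / K := by positivity
  have h : |(K ^ 2)⁻¹ * (x * y)| = |x| / K * (|y| / K) := by
    rw [abs_mul, abs_mul, abs_of_nonneg (by positivity)]; field_simp
  set p := (|x| / K) ^ (α / 2)
  set q := (|y| / K) ^ (α / 2)
  have hp : (|x| / K) ^ α = p ^ 2 := by
    rw [← Real.rpow_mul_natCast hu]; congr 1; norm_num
  have hq : (|y| / K) ^ α = q ^ 2 := by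
    rw [← Real.rpow_mul_natCast hv]; congr 1; norm_num
  rw [h, Real.mul_rpow hu hv, hp, hq]
  calc Real.exp (p * q) ≤ Real.exp (p ^ 2 / 2 + q ^ 2 / 2) := by
        gcongr; nlinarith [sq_nonneg (p - q)]
    _ = Real.exp (p ^ 2 / 2) * Real.exp (q ^ 2 / 2) := Real.exp_add _ _
    _ ≤ (Real.exp (p ^ 2 / 2) ^ 2 + Real.exp (q ^ 2 / 2) ^ 2) / 2 := by
        nlinarith [sq_nonneg (Real.exp (p ^ 2 / 2) - Real.exp (q ^ 2 / 2))]
    _ = _ := by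
        simp only [← Real.exp_nat_mul, Nat.cast_ofNat]
        congr 3 <;> ring

lemma integral_exp_mul_le_of_orliczNorm_lt {X X' : Ω → ℝ} {α K : ℝ} (hα : 0 < α) (hK : 0 < K)
    (hX : Measurable X) (hX' : Measurable X')
    (h : orliczNorm μ (psi α) X < ENNReal.ofReal K)
    (h' : orliczNorm μ (psi α) X' < ENNReal.ofReal K) :
    Integrable (fun ω => Real.exp (|(K ^ 2)⁻¹ * (X ω * X' ω)| ^ (α / 2))) μ ∧
      ∫ ω, Real.exp (|(K ^ 2)⁻¹ * (X ω * X' ω)| ^ (α / 2)) ∂μ ≤ 2 := by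
  obtain ⟨hi, hI⟩ := integral_exp_le_of_orliczNorm_lt hα hX h
  obtain ⟨hi', hI'⟩ := integral_exp_le_of_orliczNorm_lt hα hX' h'
  have hs := (hi.add hi').div_const 2
  have hi2 : Integrable (fun ω => Real.exp (|(K ^ 2)⁻¹ * (X ω * X' ω)| ^ (α / 2))) μ :=
    hs.mono' (((hX.mul hX').const_mul _).abs.pow_const _).exp.aestronglyMeasurable (ae_of_all _ fun ω => by
      rw [Real.norm_eq_abs, Real.abs_exp]; exact exp_abs_mul_rpow_le hK)
  refine ⟨hi2, (integral_mono hi2 hs fun ω => exp_abs_mul_rpow_le hK).trans ?_⟩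
  simp only [Pi.add_apply]
  rw [integral_div, integral_add hi hi']
  linarith

omit [IsProbabilityMeasure μ] in
lemma orliczNorm_lt_of_marginalNorm_le {p : ℕ} {X : Ω → Fin p → ℝ} {α : ℝ} {K : ℝ≥0} {K' : ℝ}
    (h : marginalNorm μ α X ≤ K) (hK : K < K') (j : Fin p) :
    orliczNorm μ (psi α) (fun ω => X ω j) < ENNReal.ofReal K' := by
  refine (le_iSup (fun j => orliczNorm μ (psi α) (fun ω => X ω j)) j).trans_lt (h.trans_lt ?_)
  rw [← ENNReal.ofReal_coe_nnreal]
  exact (ENNReal.ofReal_lt_ofReal_iff (K.2.trans_lt hK)).2 hK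

omit [IsProbabilityMeasure μ] in
lemma sum_variance_le_varianceFactor {n p : ℕ} (hn : 1 ≤ n) (X : Fin n → Ω → Fin p → ℝ)
    (j k : Fin p) :
    ∑ i, variance (fun ω => X i ω j * X i ω k) μ ≤ n * varianceFactor μ X ^ 2 := by
  wlog hjk : j ≤ k generalizing j k
  · simpa only [mul_comm] using this k j (le_of_not_ge hjk)
  have hn' : (0 : ℝ) < n := by exact_mod_cast hn
  set f : {jk : Fin p × Fin p // jk.1 ≤ jk.2} → ℝ := fun jk =>
    (1 / (n : ℝ)) * ∑ i, variance (fun ω => X i ω jk.1.1 * X i ω jk.1.2) μ with hf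
  have hf0 : ∀ jk, 0 ≤ f jk := fun jk =>
    mul_nonneg (by positivity) (Finset.sum_nonneg fun i _ => variance_nonneg _ _)
  have hle : f ⟨(j, k), hjk⟩ ≤ ⨆ jk, f jk := le_ciSup (Set.finite_range f).bddAbove _
  have hA : varianceFactor μ X ^ 2 = ⨆ jk, f jk := by
    rw [varianceFactor, Real.sq_sqrt (Real.iSup_nonneg hf0)]
  rw [hA]
  calc _ = n * f ⟨(j, k), hjk⟩ := by simp only [hf]; field_simp
    _ ≤ _ := by gcongr

omit [IsProbabilityMeasure μ] in
lemma varianceFactor_nonneg {n p : ℕ} (X : Fin n → Ω → Fin p → ℝ) : 0 ≤ varianceFactor μ X :=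
  Real.sqrt_nonneg _

open scoped Matrix.Norms.Elementwise in
omit [IsProbabilityMeasure μ] in
lemma gramError_le_iff {n p : ℕ} (X : Fin n → Ω → Fin p → ℝ) (ω : Ω) {r : ℝ}
    (hr : 0 ≤ r) : gramError μ X ω ≤ r ↔ ∀ j k,
      1 / (n : ℝ) * |∑ i, (X i ω j * X i ω k - ∫ ω', X i ω' j * X i ω' k ∂μ)| ≤ r := by
  rw [gramError, Matrix.norm_le_iff hr]
  refine forall₂_congr fun j k => ?_
  rw [Matrix.sub_apply, sampleGram, populationGram, Matrix.smul_apply, Matrix.smul_apply,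
    Matrix.sum_apply, Matrix.sum_apply, ← smul_sub, ← Finset.sum_sub_distrib, norm_smul,
    Real.norm_eq_abs, Real.norm_eq_abs, abs_of_nonneg (by positivity)]
  simp only [Matrix.vecMulVec_apply, Matrix.of_apply]

open scoped Matrix.Norms.Elementwise in
omit [IsProbabilityMeasure μ] in
lemma gramError_nonneg {n p : ℕ} (X : Fin n → Ω → Fin p → ℝ) (ω : Ω) : 0 ≤ gramError μ X ω := by
  exact norm_nonneg (sampleGram X ω - populationGram μ X)

/-- Deviation of one entry of the sample Gram matrix. -/
lemma measureReal_entry_le {n p : ℕ} (hn : 1 ≤ n) {X : Fin n → Ω → Fin p → ℝ} {α K s : ℝ}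
    (hα : 0 < α) (hα2 : α ≤ 2) (hK : 0 < K) (hX : ∀ i, Measurable (X i)) (hind : iIndepFun X μ)
    (hnorm : ∀ i j, orliczNorm μ (psi α) (fun ω => X i ω j) < ENNReal.ofReal K)
    (hs : 1 ≤ s) (j k : Fin p) :
    μ.real {ω | 2 * varianceFactor μ X * √(s / n) +
        scalarConst (α / 2) * K ^ 2 * Real.log (2 * n) ^ (2 / α) * s ^ (2 / α) / n <
      1 / (n : ℝ) * |∑ i, (X i ω j * X i ω k - ∫ ω', X i ω' j * X i ω' k ∂μ)|} ≤
      3 * Real.exp (-s) := by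
  have hn' : (0 : ℝ) < n := by exact_mod_cast hn
  have hXj : ∀ i j, Measurable fun ω => X i ω j := fun i j => (measurable_pi_apply j).comp (hX i)
  set A := varianceFactor μ X with hA
  have hA0 : 0 ≤ A := varianceFactor_nonneg X
  set Y : Fin n → Ω → ℝ := fun i ω => (K ^ 2)⁻¹ * (X i ω j * X i ω k) with hYdef
  have hYind : iIndepFun Y μ :=
    hind.comp (fun _ x => (K ^ 2)⁻¹ * (x j * x k)) fun _ => by fun_prop
  have hexp := fun i =>
    integral_exp_mul_le_of_orliczNorm_lt hα hK (hXj i j) (hXj i k) (hnorm i j) (hnorm i k)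
  have hV : ∑ i, variance (Y i) μ ≤ ((K ^ 2)⁻¹) ^ 2 * (n * A ^ 2) := by
    simp only [hYdef, variance_const_mul]
    rw [← Finset.mul_sum]
    gcongr
    exact sum_variance_le_varianceFactor hn X j k
  have hmain := measureReal_abs_sum_sub_integral_le hn (by positivity : 0 < α / 2)
    (by linarith) (fun i => ((hXj i j).mul (hXj i k)).const_mul _) hYind
    (fun i => (hexp i).1) (fun i => (hexp i).2) hV hs
  refine (measureReal_mono fun ω hω => ?_).trans hmain
  simp only [Set.mem_ofPred_eq] at hω ⊢
  have hsum : ∑ i, (Y i ω - ∫ ω', Y i ω' ∂μ) =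
      (K ^ 2)⁻¹ * ∑ i, (X i ω j * X i ω k - ∫ ω', X i ω' j * X i ω' k ∂μ) := by
    simp only [hYdef, integral_const_mul, ← mul_sub, Finset.mul_sum]
  have hsq : √(s * (((K ^ 2)⁻¹) ^ 2 * (n * A ^ 2))) = (K ^ 2)⁻¹ * n * A * √(s / n) := by
    rw [show s * (((K ^ 2)⁻¹) ^ 2 * (n * A ^ 2)) = ((K ^ 2)⁻¹ * n * A) ^ 2 * (s / n) by
      field_simp, Real.sqrt_mul (by positivity), Real.sqrt_sq (by positivity)]
  change 2 * √(s * (((K ^ 2)⁻¹) ^ 2 * (n * A ^ 2))) + _ < |∑ i, (Y i ω - ∫ ω', Y i ω' ∂μ)|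
  rw [hsum, hsq, abs_mul, abs_of_nonneg (by positivity : 0 ≤ (K ^ 2)⁻¹), one_div_div]
  have hmul := mul_lt_mul_of_pos_left hω (by positivity : 0 < (K ^ 2)⁻¹ * n)
  refine lt_of_eq_of_lt ?_ (hmul.trans_eq ?_) <;> field_simp

/-- Tail bound for the Gram matrix error, with the marginal norms strictly below `K`. -/
lemma measureReal_gramError_le_of_lt {n p : ℕ} (hn : 1 ≤ n) (hp : 1 ≤ p)
    {X : Fin n → Ω → Fin p → ℝ} {α K t : ℝ}
    (hα : 0 < α) (hα2 : α ≤ 2) (hK : 0 < K) (hX : ∀ i, Measurable (X i)) (hind : iIndepFun X μ)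
    (hnorm : ∀ i j, orliczNorm μ (psi α) (fun ω => X i ω j) < ENNReal.ofReal K) :
    μ.real {ω | 2 * varianceFactor μ X * √((t + 2 * Real.log p) / n) +
        scalarConst (α / 2) * K ^ 2 * Real.log (2 * n) ^ (2 / α) *
          (t + 2 * Real.log p) ^ (2 / α) / n < gramError μ X ω} ≤
      3 * Real.exp (-t) := by
  have hn' : (1 : ℝ) ≤ n := by exact_mod_cast hn
  have hp' : (1 : ℝ) ≤ p := by exact_mod_cast hp
  have hlp : 0 ≤ Real.log p := Real.log_nonneg hp'
  have hln : 0 ≤ Real.log (2 * n) := Real.log_nonneg (by linarith)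
  have hC := scalarConst_pos (b := α / 2) (by positivity)
  have hA0 := varianceFactor_nonneg (μ := μ) X
  -- For t < 1 the right side exceeds 1. Otherwise s = t + 2 log p ≥ 1, as the scalar inequality
  -- requires, and p² exp(-s) = exp(-t).
  rcases lt_or_ge t 1 with ht1 | ht1
  · refine measureReal_le_one.trans ?_
    have h1 : Real.exp (-1) ≤ Real.exp (-t) := Real.exp_le_exp.2 (by linarith)
    have h2 := Real.exp_neg_one_gt_d9
    linarith
  set s := t + 2 * Real.log p with hs
  have hs1 : 1 ≤ s := by linarith
  set r := 2 * varianceFactor μ X * √(s / n) +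
    scalarConst (α / 2) * K ^ 2 * Real.log (2 * n) ^ (2 / α) * s ^ (2 / α) / n with hr
  have hr0 : 0 ≤ r := by positivity
  have hsub : {ω | r < gramError μ X ω} ⊆ ⋃ jk ∈ (Finset.univ : Finset (Fin p × Fin p)),
      {ω | r < 1 / (n : ℝ) *
        |∑ i, (X i ω jk.1 * X i ω jk.2 - ∫ ω', X i ω' jk.1 * X i ω' jk.2 ∂μ)|} := by
    intro ω hω
    simp only [Set.mem_ofPred_eq] at hω
    rw [← not_le, gramError_le_iff X ω hr0] at hω
    push Not at hω
    obtain ⟨j, k, h⟩ := hω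
    simp only [Set.mem_iUnion]
    exact ⟨(j, k), Finset.mem_univ _, h⟩
  calc μ.real {ω | r < gramError μ X ω} ≤ _ := measureReal_mono hsub (measure_ne_top _ _)
    _ ≤ _ := measureReal_biUnion_finset_le _ _
    _ ≤ ∑ _jk : Fin p × Fin p, 3 * Real.exp (-s) := Finset.sum_le_sum fun jk _ =>
        measureReal_entry_le hn hα hα2 hK hX hind hnorm hs1 jk.1 jk.2
    _ = 3 * Real.exp (-t) := by
        rw [Finset.sum_const, Finset.card_univ, Fintype.card_prod, Fintype.card_fin, nsmul_eq_mul,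
          show -s = -t - (Real.log p + Real.log p) by rw [hs]; ring, Real.exp_sub, Real.exp_add,
          Real.exp_log (by linarith)]
        push_cast
        field_simp

/-- Tail bound for the Gram matrix error. -/
theorem measureReal_gramError_le {n p : ℕ} (hn : 1 ≤ n) (hp : 1 ≤ p)
    {X : Fin n → Ω → Fin p → ℝ} {α t : ℝ} {K : ℝ≥0}
    (hα : 0 < α) (hα2 : α ≤ 2) (hX : ∀ i, Measurable (X i)) (hind : iIndepFun X μ)
    (hnorm : ∀ i, marginalNorm μ α (X i) ≤ K) (ht : 0 ≤ t) :
    μ.real {ω | 2 * varianceFactor μ X * √((t + 2 * Real.log p) / n) +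
        scalarConst (α / 2) * (K : ℝ) ^ 2 * Real.log (2 * n) ^ (2 / α) *
          (t + 2 * Real.log p) ^ (2 / α) / n < gramError μ X ω} ≤
      3 * Real.exp (-t) := by
  set g : ℝ → ℝ := fun x => 2 * varianceFactor μ X * √((t + 2 * Real.log p) / n) +
        scalarConst (α / 2) * x ^ 2 * Real.log (2 * n) ^ (2 / α) *
          (t + 2 * Real.log p) ^ (2 / α) / n with hg
  have hgc : Continuous g := by fun_prop
  have hn' : (1 : ℝ) ≤ n := by exact_mod_cast hn
  have hp' : (1 : ℝ) ≤ p := by exact_mod_cast hp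
  have hlp : 0 ≤ Real.log p := Real.log_nonneg hp'
  have hln : 0 ≤ Real.log (2 * n) := Real.log_nonneg (by linarith)
  have hC := scalarConst_pos (b := α / 2) (by positivity)
  have hgm : ∀ x y, 0 ≤ x → x ≤ y → g x ≤ g y := fun x y hx hxy => by
    simp only [hg]; gcongr
  -- The strict version is applied at levels decreasing to K, which also covers K = 0. The events
  -- increase to the desired one, so continuity from below gives the limit.
  obtain ⟨u, hu, huK, hulim⟩ := exists_seq_strictAnti_tendsto (K : ℝ)
  have hmono : Monotone fun m => {ω | g (u m) < gramError μ X ω} := fun a b hab ω hω =>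
    (hgm _ _ (K.2.trans (huK b).le) (hu.antitone hab)).trans_lt hω
  have hunion : {ω | g K < gramError μ X ω} = ⋃ m, {ω | g (u m) < gramError μ X ω} := by
    ext ω
    simp only [Set.mem_iUnion, Set.mem_ofPred_eq]
    refine ⟨fun h => ?_, fun ⟨m, hm⟩ => (hgm _ _ K.2 (huK m).le).trans_lt hm⟩
    exact (((hgc.tendsto _).comp hulim).eventually_lt_const h).exists
  have hlim := tendsto_measure_iUnion_atTop (μ := μ) hmono
  rw [← hunion] at hlim
  have hlim' := (ENNReal.tendsto_toReal (measure_ne_top μ _)).comp hlim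
  refine le_of_tendsto' hlim' fun m => ?_
  exact measureReal_gramError_le_of_lt hn hp hα hα2 (K.2.trans_lt (huK m)) hX hind
    (fun i j => orliczNorm_lt_of_marginalNorm_le (hnorm i) (huK m) j)

/-- The variance factor is at most a constant multiple of the squared marginal norm bound. -/
lemma varianceFactor_le {n p : ℕ} (hn : 1 ≤ n) {X : Fin n → Ω → Fin p → ℝ} {α : ℝ} {K : ℝ≥0}
    (hα : 0 < α) (hX : ∀ i, Measurable (X i)) (hnorm : ∀ i, marginalNorm μ α (X i) ≤ K) :
    varianceFactor μ X ≤ 2 * (4 / α) ^ (2 / α) * (K : ℝ) ^ 2 := by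
  have hn' : (0 : ℝ) < n := by exact_mod_cast hn
  have hXj : ∀ i j, Measurable fun ω => X i ω j := fun i j => (measurable_pi_apply j).comp (hX i)
  obtain ⟨u, -, huK, hulim⟩ := exists_seq_strictAnti_tendsto (K : ℝ)
  have hlim : Tendsto (fun m => 2 * (4 / α) ^ (2 / α) * u m ^ 2) atTop
      (nhds (2 * (4 / α) ^ (2 / α) * (K : ℝ) ^ 2)) := (hulim.pow 2).const_mul _
  refine ge_of_tendsto' hlim fun m => ?_
  have hu0 : 0 < u m := K.2.trans_lt (huK m)
  set D := (4 / α) ^ (2 / α) with hD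
  have hD' : (2 / (α / 2)) ^ (1 / (α / 2)) = D := by
    rw [hD, one_div_div]; congr 1; field_simp; norm_num
  have hD0 : 0 ≤ D := by positivity
  have hvar : ∀ i j k, variance (fun ω => X i ω j * X i ω k) μ ≤ (2 * D * u m ^ 2) ^ 2 := by
    intro i j k
    have hexp := integral_exp_mul_le_of_orliczNorm_lt hα hu0 (hXj i j) (hXj i k)
      (orliczNorm_lt_of_marginalNorm_le (hnorm i) (huK m) j)
      (orliczNorm_lt_of_marginalNorm_le (hnorm i) (huK m) k)
    have hYm : Measurable fun ω => (u m ^ 2)⁻¹ * (X i ω j * X i ω k) :=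
      ((hXj i j).mul (hXj i k)).const_mul _
    have h2 := (integral_sq_le_of_integral_exp_le (by positivity : 0 < α / 2)
      hYm hexp.1 hexp.2).2
    rw [hD'] at h2
    have hv := (variance_le_expectation_sq hYm.aestronglyMeasurable (μ := μ)).trans h2
    rw [variance_const_mul, inv_pow, inv_mul_le_iff₀ (by positivity)] at hv
    -- The moment bound gives 2D²u⁴; enlarging 2 to 4 makes it a perfect square.
    nlinarith [sq_nonneg (u m ^ 2 * D)]
  unfold varianceFactor
  refine Real.sqrt_le_iff.2 ⟨by positivity, Real.iSup_le (fun jk => ?_) (sq_nonneg _)⟩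
  refine (mul_le_mul_of_nonneg_left (Finset.sum_le_sum fun i _ => hvar i _ _)
    (by positivity)).trans ?_
  rw [Finset.sum_const, Finset.card_univ, Fintype.card_fin, nsmul_eq_mul]
  apply le_of_eq; field_simp

end Gram

/-! ### Rates in probability -/

lemma IsBigOInProb.mono {Ω : ℕ → Type*} [∀ n, MeasurableSpace (Ω n)] {μ : ∀ n, Measure (Ω n)}
    [∀ n, IsProbabilityMeasure (μ n)] {Y : ∀ n, Ω n → ℝ} {r r' : ℕ → ℝ} {c : ℝ}
    (h : IsBigOInProb μ Y r) (hc : 0 < c) (hr : ∀ᶠ n in atTop, r n ≤ c * r' n) :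
    IsBigOInProb μ Y r' := by
  intro ε hε
  obtain ⟨M, hM, hev⟩ := h ε hε
  refine ⟨M * c, by positivity, ?_⟩
  filter_upwards [hev, hr] with n hn hrn
  refine (measureReal_mono fun ω hω => ?_).trans hn
  simp only [Set.mem_ofPred_eq] at hω ⊢
  exact lt_of_le_of_lt (by rw [mul_assoc]; gcongr) hω

section Rates

variable {Ω : ℕ → Type*} [∀ n, MeasurableSpace (Ω n)] {μ : ∀ n, Measure (Ω n)}
  [∀ n, IsProbabilityMeasure (μ n)] {p : ℕ → ℕ} {X : ∀ n, Fin n → Ω n → Fin (p n) → ℝ}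
  {K : ℕ → ℝ≥0} {α : ℝ}

/-- The general rate of convergence of the Gram matrix error along a triangular array. -/
theorem isBigOInProb_gramError (hα : 0 < α) (hα2 : α ≤ 2) (hp : ∀ n, 2 ≤ p n)
    (hX : ∀ n i, Measurable (X n i)) (hind : ∀ n, iIndepFun (X n) (μ n))
    (hnorm : ∀ n i, marginalNorm (μ n) α (X n i) ≤ (K n : ℝ≥0∞)) :
    IsBigOInProb μ (fun n => gramError (μ n) (X n)) (fun n => max
      (varianceFactor (μ n) (X n) * √(Real.log (p n) / n))
      ((K n : ℝ) ^ 2 * (Real.log n ^ (2 / α) * Real.log (p n) ^ (2 / α) / n))) := by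
  intro ε hε
  set t := max 0 (Real.log (3 / ε)) with htdef
  have ht : 0 ≤ t := le_max_left _ _
  have htε : 3 * Real.exp (-t) ≤ ε := by
    have h : Real.exp (-t) ≤ Real.exp (-Real.log (3 / ε)) :=
      Real.exp_le_exp.2 (neg_le_neg (le_max_right _ _))
    rw [Real.exp_neg (Real.log _), Real.exp_log (by positivity), inv_div] at h
    linarith
  have hC := scalarConst_pos (b := α / 2) (by positivity)
  set C := scalarConst (α / 2)
  -- Since p ≥ 2 gives log p ≥ 1/2, the term t is at most 2t log p.
  set c := 2 * t + 2 with hc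
  have hc0 : 0 < c := by positivity
  refine ⟨2 * √c + C * 2 ^ (2 / α) * c ^ (2 / α), by positivity, ?_⟩
  filter_upwards [eventually_ge_atTop 2] with n hn
  have hn' : (2 : ℝ) ≤ n := by exact_mod_cast hn
  have hp' : (2 : ℝ) ≤ p n := by exact_mod_cast hp n
  have hlp : 1 / 2 ≤ Real.log (p n) := by
    have h1 : Real.log 2 ≤ Real.log (p n) := Real.log_le_log (by norm_num) hp'
    linarith [Real.log_two_gt_d9]
  have hln0 : 0 ≤ Real.log n := Real.log_nonneg (by linarith)
  have hln20 : 0 ≤ Real.log (2 * n) := Real.log_nonneg (by linarith)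
  have hln : Real.log (2 * n) ≤ 2 * Real.log n := by
    rw [Real.log_mul (by norm_num) (by linarith)]
    linarith [Real.log_le_log (by norm_num) hn']
  have hs : t + 2 * Real.log (p n) ≤ c * Real.log (p n) := by
    rw [hc]; nlinarith
  have hA0 := varianceFactor_nonneg (μ := μ n) (X n)
  refine (measureReal_mono fun ω hω => ?_).trans
    ((measureReal_gramError_le (by omega) (by linarith [hp n]) hα hα2 (hX n) (hind n)
      (hnorm n) ht).trans htε)
  simp only [Set.mem_ofPred_eq] at hω ⊢
  rw [abs_of_nonneg (gramError_nonneg _ _)] at hω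
  refine lt_of_le_of_lt ?_ hω
  rw [add_mul]
  refine add_le_add ?_ ?_
  · calc 2 * varianceFactor (μ n) (X n) * √((t + 2 * Real.log (p n)) / n)
        ≤ 2 * varianceFactor (μ n) (X n) * √(c * (Real.log (p n) / n)) := by
          rw [← mul_div_assoc]; gcongr
      _ = 2 * √c * (varianceFactor (μ n) (X n) * √(Real.log (p n) / n)) := by
          rw [Real.sqrt_mul hc0.le]; ring
      _ ≤ _ := by gcongr; exact le_max_left _ _
  · calc C * (K n : ℝ) ^ 2 * Real.log (2 * n) ^ (2 / α) *
          (t + 2 * Real.log (p n)) ^ (2 / α) / n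
        ≤ C * (K n : ℝ) ^ 2 * (2 * Real.log n) ^ (2 / α) * (c * Real.log (p n)) ^ (2 / α) / n := by
          gcongr
      _ = C * 2 ^ (2 / α) * c ^ (2 / α) *
          ((K n : ℝ) ^ 2 * (Real.log n ^ (2 / α) * Real.log (p n) ^ (2 / α) / n)) := by
          rw [Real.mul_rpow (by norm_num) hln0, Real.mul_rpow hc0.le (by linarith)]; ring
      _ ≤ _ := by gcongr; exact le_max_right _ _

/-- Divided by √(log p / n), the claim reads (log p)^(2/α - 1/2) ≤ √n (log n)^(-2/α), which is the
little-o condition with constant 1. -/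
lemma eventually_log_rpow_div_le (hp : ∀ n, 2 ≤ p n)
    (h : (fun n : ℕ => Real.log (p n) ^ (2 / α - 1 / 2)) =o[atTop]
      (fun n : ℕ => √(n : ℝ) * Real.log n ^ (-(2 / α)))) :
    ∀ᶠ n : ℕ in atTop,
      Real.log n ^ (2 / α) * Real.log (p n) ^ (2 / α) / n ≤ √(Real.log (p n) / n) := by
  filter_upwards [h.bound one_pos, eventually_ge_atTop 2] with n hb hn
  have hn' : (2 : ℝ) ≤ n := by exact_mod_cast hn
  have hp' : (2 : ℝ) ≤ p n := by exact_mod_cast hp n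
  have hlp : 0 < Real.log (p n) := Real.log_pos (by linarith)
  have hln : 0 < Real.log n := Real.log_pos (by linarith)
  rw [one_mul, Real.norm_of_nonneg (by positivity), Real.norm_of_nonneg (by positivity),
    Real.rpow_sub hlp, ← Real.sqrt_eq_rpow, Real.rpow_neg hln.le, ← div_eq_mul_inv,
    div_le_div_iff₀ (by positivity) (by positivity)] at hb
  have hsn : 0 < √(n : ℝ) := Real.sqrt_pos.2 (by linarith)
  rw [Real.sqrt_div hlp.le, div_le_div_iff₀ (by linarith) hsn]
  calc Real.log n ^ (2 / α) * Real.log (p n) ^ (2 / α) * √(n : ℝ)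
      ≤ (√(n : ℝ) * √(Real.log (p n))) * √(n : ℝ) := by
        rw [mul_comm (Real.log n ^ (2 / α))]
        exact mul_le_mul_of_nonneg_right hb hsn.le
    _ = √(Real.log (p n)) * (√(n : ℝ) * √(n : ℝ)) := by ring
    _ = √(Real.log (p n)) * n := by rw [Real.mul_self_sqrt (by linarith)]

/-- Both terms of the maximum are dominated: the first by `varianceFactor_le`, the second by
`eventually_log_rpow_div_le`. -/
theorem isBigOInProb_gramError_of_isLittleO (hα : 0 < α) (hα2 : α ≤ 2) (hp : ∀ n, 2 ≤ p n)
    (hX : ∀ n i, Measurable (X n i)) (hind : ∀ n, iIndepFun (X n) (μ n))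
    (hnorm : ∀ n i, marginalNorm (μ n) α (X n i) ≤ (K n : ℝ≥0∞))
    (h : (fun n : ℕ => Real.log (p n) ^ (2 / α - 1 / 2)) =o[atTop]
      (fun n : ℕ => √(n : ℝ) * Real.log n ^ (-(2 / α)))) :
    IsBigOInProb μ (fun n => gramError (μ n) (X n))
      (fun n => (K n : ℝ) ^ 2 * √(Real.log (p n) / n)) := by
  refine (isBigOInProb_gramError hα hα2 hp hX hind hnorm).mono
    (c := 2 * (4 / α) ^ (2 / α) + 1) (by positivity) ?_
  filter_upwards [eventually_log_rpow_div_le hp h, eventually_ge_atTop 1] with n hb hn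
  have hA := varianceFactor_le hn hα (hX n) (hnorm n)
  have hq : 0 ≤ (K n : ℝ) ^ 2 * √(Real.log (p n) / n) := by positivity
  refine max_le ?_ ?_
  · have := mul_le_mul_of_nonneg_right hA (Real.sqrt_nonneg (Real.log (p n) / n))
    linarith
  · have := mul_le_mul_of_nonneg_left hb (sq_nonneg (K n : ℝ))
    have h0 : 0 ≤ 2 * (4 / α) ^ (2 / α) * ((K n : ℝ) ^ 2 * √(Real.log (p n) / n)) := by
      positivity
    linarith

end Rates

end SubWeibull

/-! ### The tail bound and its consequences -/

theorem mainTheorem5 (α : ℝ) (hα : 0 < α) (hα2 : α ≤ 2) :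
    -- the finite-sample tail bound
    (∃ C : ℝ, 0 < C ∧
      ∀ (Ω : Type*) [MeasurableSpace Ω] (μ : Measure Ω) [IsProbabilityMeasure μ]
        (n p : ℕ) (_ : 1 ≤ n) (_ : 1 ≤ p) (X : Fin n → Ω → Fin p → ℝ) (K : ℝ≥0),
        (∀ i, Measurable (X i)) → iIndepFun X μ →
        (∀ i, SubWeibull.marginalNorm μ α (X i) ≤ (K : ℝ≥0∞)) →
        ∀ t : ℝ, 0 ≤ t →
          1 - 3 * Real.exp (-t) ≤
            μ.real {ω | SubWeibull.gramError μ X ω ≤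
              7 * SubWeibull.varianceFactor μ X * √((t + 2 * Real.log p) / n) +
                C * (K : ℝ) ^ 2 * Real.log (2 * n) ^ (2 / α) *
                  (t + 2 * Real.log p) ^ (2 / α) / n}) ∧
    -- the rates of convergence along a triangular array
    (∀ (Ω : ℕ → Type*) [∀ n, MeasurableSpace (Ω n)] (μ : ∀ n, Measure (Ω n))
        [∀ n, IsProbabilityMeasure (μ n)] (p : ℕ → ℕ) (_ : ∀ n, 2 ≤ p n)
        (X : ∀ n, Fin n → Ω n → Fin (p n) → ℝ) (K : ℕ → ℝ≥0),
        (∀ n i, Measurable (X n i)) → (∀ n, iIndepFun (X n) (μ n)) →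
        (∀ n i, SubWeibull.marginalNorm (μ n) α (X n i) ≤ (K n : ℝ≥0∞)) →
        SubWeibull.IsBigOInProb μ (fun n => SubWeibull.gramError (μ n) (X n))
          (fun n => max
            (SubWeibull.varianceFactor (μ n) (X n) * √(Real.log (p n) / n))
            ((K n : ℝ) ^ 2 * (Real.log n ^ (2 / α) * Real.log (p n) ^ (2 / α) / n))) ∧
        ((fun n : ℕ => Real.log (p n) ^ (2 / α - 1 / 2)) =o[atTop]
            (fun n : ℕ => √(n : ℝ) * Real.log n ^ (-(2 / α))) →
          SubWeibull.IsBigOInProb μ (fun n => SubWeibull.gramError (μ n) (X n))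
            (fun n => (K n : ℝ) ^ 2 * √(Real.log (p n) / n)) ∧
          ((fun n => (K n : ℝ) ^ 2) =O[atTop]
              (fun n => SubWeibull.varianceFactor (μ n) (X n)) →
            SubWeibull.IsBigOInProb μ (fun n => SubWeibull.gramError (μ n) (X n))
              (fun n => SubWeibull.varianceFactor (μ n) (X n) *
                √(Real.log (p n) / n))))) := by
  refine ⟨⟨SubWeibull.scalarConst (α / 2), SubWeibull.scalarConst_pos (by positivity), ?_⟩, ?_⟩
  · intro Ω _ μ _ n p hn hp X K hX hind hnorm t ht
    have hA0 := SubWeibull.varianceFactor_nonneg (μ := μ) X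
    have htail := SubWeibull.measureReal_gramError_le hn hp hα hα2 hX hind hnorm ht
    set S := {ω | SubWeibull.gramError μ X ω ≤
      7 * SubWeibull.varianceFactor μ X * √((t + 2 * Real.log p) / n) +
        SubWeibull.scalarConst (α / 2) * (K : ℝ) ^ 2 * Real.log (2 * n) ^ (2 / α) *
          (t + 2 * Real.log p) ^ (2 / α) / n}
    have hcompl : μ.real Sᶜ ≤ 3 * Real.exp (-t) := by
      refine (measureReal_mono fun ω hω => ?_).trans htail
      simp only [S, Set.mem_compl_iff, Set.mem_ofPred_eq, not_le] at hω ⊢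
      -- The argument gives the constant 2, which is relaxed to 7.
      exact lt_of_le_of_lt (by gcongr; norm_num) hω
    -- Subadditivity suffices in place of the complement rule, so measurability of S plays no role.
    have huniv := measureReal_union_le (μ := μ) S Sᶜ
    rw [Set.union_compl_self, probReal_univ] at huniv
    linarith
  · intro Ω _ μ _ p hp X K hX hind hnorm
    refine ⟨SubWeibull.isBigOInProb_gramError hα hα2 hp hX hind hnorm, fun h => ?_⟩
    have hrate := SubWeibull.isBigOInProb_gramError_of_isLittleO hα hα2 hp hX hind hnorm h
    refine ⟨hrate, fun hKA => ?_⟩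
    obtain ⟨c, hc, hbound⟩ := hKA.exists_pos
    refine hrate.mono hc ?_
    filter_upwards [hbound.bound] with n hn
    rw [Real.norm_of_nonneg (by positivity),
      Real.norm_of_nonneg (SubWeibull.varianceFactor_nonneg _)] at hn
    rw [← mul_assoc]
    exact mul_le_mul_of_nonneg_right hn (Real.sqrt_nonneg _)
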